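/- Fix countably infinite, disjoint sets of concept names $A$ and role names $r$. A *role* is a role name $r$ or an inverse role $r^-$. Concepts are built by $$C,D ::= \top \mid A \mid \neg C \mid C\sqcap D \mid C\sqcup D \mid \forall R.C \mid \exists R.C \mid (\le 1\,R),$$ with $A$ a concept name and $R$ a role. An interpretation $\mathcal I$ consists of a non-empty domain $\Delta^{\mathcal I}$, sets $A^{\mathcal I}\subseteq\Delta^{\mathcal I}$ and relations $r^{\mathcal I}\subseteq\Delta^{\mathcal I}\times\Delta^{\mathcal I}$; $(r^-)^{\mathcal I}$ is the converse of $r^{\mathcal I}$, concepts have their usual extensions $C^{\mathcal I}\subseteq \Delta^{\mathcal I}$, and $(\le 1\,R)^{\mathcal I}$ is the set of all $d$ having at most one $R^{\mathcal I}$-successor. An ontology is a finite set of concept inclusions $C\sqsubseteq D$ (satisfied in $\mathcal I$ if $C^{\mathcal I}\subseteq D^{\mathcal I}$) and transitivity declarations $\mathsf{trans}(r)$ with $r$ a role name (satisfied if $r^{\mathcal I}$ is transitive). $\mathcal O\models C\sqsubseteq D$ means that every interpretation satisfying all of $\mathcal O$ satisfies $C\sqsubseteq D$, and $\mathrm{sig}(X)$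 is the set of concept and role names occurring in $X$, with $\mathrm{sig}(\mathcal O,C)=\mathrm{sig}(\mathcal O)\cup\mathrm{sig}(C)$. Let $\mathcal L$ be $\mathcal{ALC}$ or its extension by any subset of $\{\mathcal S,\mathcal I,\mathcal F\}$. So transitivity declarations are available only with $\mathcal S$, inverse roles only with $\mathcal I$, and functionality restrictions $(\le 1\,R)$ only with $\mathcal F$. As usual, functionality restrictions may be imposed only on simple roles: relative to an ontology $\mathcal O$, $(\le 1\,r)$ and $(\le 1\,r^-)$ are admitted only if $\mathsf{trans}(r)\notin\mathcal O$. **Theorem.** $\mathcal L$ has the Craig interpolation property. That is, let $\mathcal O_1,\mathcal O_2$ be such that $\mathcal O_1\cup\mathcal O_2$ is an $\mathcal L$ ontology and let $C_1,C_2$ be $\mathcal L$ concepts, where simplicity of roles is understood relative to $\mathcal O_1\cup\mathcal O_2$. If $\mathcal O_1\cup\mathcal O_2\models C_1\sqsubseteq C_2$, then there is an $\mathcal L$ concept $I$ (again relative to $\mathcal O_1\cup\mathcal O_2$) with $$\mathrm{sig}(I)\subseteq \mathrm{sig}(\mathcal O_1,C_1)\cap \mathrm{sig}(\mathcal O_2,C_2),\qquad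 \mathcal O_1\cup\mathcal O_2\models C_1\sqsubseteq I,\qquad \mathcal O_1\cup\mathcal O_2\models I\sqsubseteq C_2 .$$ -/

import Mathlib

universe u

namespace DescriptionLogic

/-- Roles: role names `r` and inverse roles `r⁻`. -/
inductive Role (NR : Type) : Type
  | name (r : NR)
  | inv (r : NR)

/-- The role name on which a role is built. -/
def Role.base {NR : Type} : Role NR → NR
  | .name r => r
  | .inv r => r

/-- Concepts in the largest language considered, with concept names `NC` and role names `NR`.
The individual description logics are carved out by `DL.IsConcept`. -/
inductive Concept (NC NR : Type) : Type
  | top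
  | atom (A : NC)
  | neg (C : Concept NC NR)
  | and (C D : Concept NC NR)
  | or (C D : Concept NC NR)
  | all (R : Role NR) (C : Concept NC NR)
  | ex (R : Role NR) (C : Concept NC NR)
  | atMostOne (R : Role NR)

/-- Axioms: concept inclusions `C ⊑ D` and transitivity declarations `trans(r)`. -/
inductive OntAxiom (NC NR : Type) : Type
  | incl (C D : Concept NC NR)
  | trans (r : NR)

/-- Sets of axioms; an ontology is such a set satisfying `DL.IsOntology`, so in particular a
finite one. -/
abbrev AxiomSet (NC NR : Type) : Type := Set (OntAxiom NC NR)

/-! ### Semantics -/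

/-- Interpretations: a non-empty domain together with the extensions of all concept names and
role names. (None of the concept languages here mentions individual names.) -/
structure Interpretation (NC NR : Type) : Type (u + 1) where
  carrier : Type u
  nonempty : Nonempty carrier
  conceptExt : NC → Set carrier
  roleExt : NR → Set (carrier × carrier)

/-- The extension of a role. -/
def Role.ext {NC NR : Type} (I : Interpretation.{u} NC NR) : Role NR → Set (I.carrier × I.carrier)
  | .name r => I.roleExt r
  | .inv r => {p | (p.2, p.1) ∈ I.roleExt r}

/-- The extension of a concept. -/
def Concept.ext {NC NR : Type} (I : Interpretation.{u} NC NR) : Concept NC NR → Set I.carrier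
  | .top => Set.univ
  | .atom A => I.conceptExt A
  | .neg C => (C.ext I)ᶜ
  | .and C D => C.ext I ∩ D.ext I
  | .or C D => C.ext I ∪ D.ext I
  | .all R C => {d | ∀ e, (d, e) ∈ R.ext I → e ∈ C.ext I}
  | .ex R C => {d | ∃ e, (d, e) ∈ R.ext I ∧ e ∈ C.ext I}
  | .atMostOne R => {d | ∀ e e', (d, e) ∈ R.ext I → (d, e') ∈ R.ext I → e = e'}

/-- Satisfaction of an axiom in an interpretation. -/
def Interpretation.Satisfies {NC NR : Type} (I : Interpretation.{u} NC NR) :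
    OntAxiom NC NR → Prop
  | .incl C D => C.ext I ⊆ D.ext I
  | .trans r => ∀ d e f, (d, e) ∈ I.roleExt r → (e, f) ∈ I.roleExt r → (d, f) ∈ I.roleExt r

/-- `I` is a model of `O`. -/
def Interpretation.IsModel {NC NR : Type} (I : Interpretation.{u} NC NR)
    (O : AxiomSet NC NR) : Prop :=
  ∀ α ∈ O, I.Satisfies α

/-- `O ⊨ C ⊑ D`: every model of `O` satisfies `C ⊑ D`. -/
def Entails {NC NR : Type} (O : AxiomSet NC NR) (C D : Concept NC NR) : Prop :=
  ∀ I : Interpretation.{u} NC NR, I.IsModel O → I.Satisfies (.incl C D)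

/-! ### Signatures -/

/-- Non-logical symbols: concept names and role names. -/
inductive Symbol (NC NR : Type) : Type
  | concept (A : NC)
  | role (r : NR)

/-- The symbols used in a concept. -/
def Concept.sig {NC NR : Type} : Concept NC NR → Set (Symbol NC NR)
  | .top => ∅
  | .atom A => {.concept A}
  | .neg C => C.sig
  | .and C D => C.sig ∪ D.sig
  | .or C D => C.sig ∪ D.sig
  | .all R C => {.role R.base} ∪ C.sig
  | .ex R C => {.role R.base} ∪ C.sig
  | .atMostOne R => {.role R.base}

/-- The symbols used in an axiom. -/
def OntAxiom.sig {NC NR : Type} : OntAxiom NC NR → Set (Symbol NC NR)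
  | .incl C D => C.sig ∪ D.sig
  | .trans r => {.role r}

/-- The symbols used in a set of axioms. -/
def AxiomSet.sig {NC NR : Type} (O : AxiomSet NC NR) : Set (Symbol NC NR) :=
  ⋃ α ∈ O, α.sig

/-! ### The description logics -/

/-- A description logic between ALC and its extension by all of S, I, F: the three fields say
which of transitive roles (S), inverse roles (I) and functionality restrictions (F) are
available. `⟨False, False, False⟩` is ALC itself. -/
structure DL : Type where
  transitivity : Prop
  inverse : Prop
  functionality : Prop

/-- Role names are always available, inverse roles only in the presence of I. -/
def DL.IsRole {NR : Type} (L : DL) : Role NR → Prop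
  | .name _ => True
  | .inv _ => L.inverse

/-- `L.IsConcept O C`: `C` is a concept of the description logic `L`, where the axioms in `O` fix
which role names are declared transitive. The usual syntactic restriction applies: functionality
restrictions are imposed only on simple roles, which here (there are no role hierarchies)
means roles `r`, `r⁻` with `r` not declared transitive. -/
def DL.IsConcept {NC NR : Type} (L : DL) (O : AxiomSet NC NR) : Concept NC NR → Prop
  | .top => True
  | .atom _ => True
  | .neg C => L.IsConcept O C
  | .and C D => L.IsConcept O C ∧ L.IsConcept O D
  | .or C D => L.IsConcept O C ∧ L.IsConcept O D
  | .all R C => L.IsRole R ∧ L.IsConcept O C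
  | .ex R C => L.IsRole R ∧ L.IsConcept O C
  | .atMostOne R => L.functionality ∧ L.IsRole R ∧ OntAxiom.trans R.base ∉ O

/-- `L.IsAxiom O α`: `α` is an axiom of `L`, relative to the transitivity declarations in `O`. -/
def DL.IsAxiom {NC NR : Type} (L : DL) (O : AxiomSet NC NR) : OntAxiom NC NR → Prop
  | .incl C D => L.IsConcept O C ∧ L.IsConcept O D
  | .trans _ => L.transitivity

/-- `O` is an ontology of `L`: a finite set of axioms of `L`. -/
def DL.IsOntology {NC NR : Type} (L : DL) (O : AxiomSet NC NR) : Prop :=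
  O.Finite ∧ ∀ α ∈ O, L.IsAxiom O α

/-- `J` is an `L(S)`-interpolant for `C₁` and `C₂` under `O`. -/
def DL.IsInterpolant {NC NR : Type} (L : DL) (S : Set (Symbol NC NR)) (O : AxiomSet NC NR)
    (C₁ C₂ J : Concept NC NR) : Prop :=
  L.IsConcept O J ∧ J.sig ⊆ S ∧ Entails.{u} O C₁ J ∧ Entails.{u} O J C₂

/-- The Craig interpolation property. Being an ontology (or a concept) of `L` is required of the
union `O₁ ∪ O₂` (relative to that union), so that a role declared transitive in one of `O₁`, `O₂`
is not subject to functionality restrictions in the other one; this entails that `O₁` and `O₂`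
are ontologies of `L` themselves, and is equivalent to it unless `L` has both S and F. -/
def DL.HasCIP (L : DL) (NC NR : Type) : Prop :=
  ∀ (O₁ O₂ : AxiomSet NC NR) (C₁ C₂ : Concept NC NR),
    L.IsOntology (O₁ ∪ O₂) →
    L.IsConcept (O₁ ∪ O₂) C₁ →
    L.IsConcept (O₁ ∪ O₂) C₂ →
    Entails.{u} (O₁ ∪ O₂) C₁ C₂ →
    ∃ J : Concept NC NR,
      L.IsInterpolant.{u} ((AxiomSet.sig O₁ ∪ C₁.sig) ∩ (AxiomSet.sig O₂ ∪ C₂.sig)) (O₁ ∪ O₂)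
        C₁ C₂ J

end DescriptionLogic

/-! Argue by contraposition. If there is no interpolant, no finite list of concepts over the shared
signature separates `C₁` from the complement of `C₂` in all models (`exists_interpolant_of_list`).
Gathering the countably many resulting counterexamples in one disjoint union and passing to an
ultrapower yields a single model with indistinguishable elements `x` in `C₁` and `y` outside `C₂`.

Saturation makes indistinguishability a bisimulation over the shared signature. The amalgam consists
of the indistinguishable pairs, each multiplied by a set `K`; its projections should be bounded
morphisms for the two signatures, so that it is a model of `O₁ ∪ O₂` with a point over `(x, y)`
refuting `C₁ ⊑ C₂`.

The plain product of bisimilar pairs fails for functionality: a role of one signature only would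
relate a pair to all pairs over a given successor. Hence edges must preserve a colour, chosen so
that each successor lifts to exactly one point of a given colour. Equality of colours is an
equivalence relation, so transitivity survives and inverse roles are treated symmetrically. -/

namespace DescriptionLogic

open Filter

variable {NC NR : Type}

/-! ### Bounded morphisms -/

/-- A map preserving and reflecting all concepts of `L` (relative to `O`) over the
signature `S`. -/
structure IsBoundedMorphism (L : DL) (O : AxiomSet NC NR) (S : Set (Symbol NC NR))
    (I J : Interpretation.{u} NC NR) (f : I.carrier → J.carrier) : Prop where
  atom : ∀ A, Symbol.concept A ∈ S → ∀ x, x ∈ I.conceptExt A ↔ f x ∈ J.conceptExt A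
  forth : ∀ R, L.IsRole R → Symbol.role R.base ∈ S → ∀ x y, (x, y) ∈ R.ext I →
    (f x, f y) ∈ R.ext J
  back : ∀ R, L.IsRole R → Symbol.role R.base ∈ S → ∀ x z, (f x, z) ∈ R.ext J →
    ∃ y, (x, y) ∈ R.ext I ∧ f y = z
  func : ∀ R, L.functionality → L.IsRole R → OntAxiom.trans R.base ∉ O →
    Symbol.role R.base ∈ S → ∀ x, f x ∈ (Concept.atMostOne R).ext J →
      x ∈ (Concept.atMostOne R).ext I

/-- For functionality only one direction is a clause of the structure; the other follows from
`back`. -/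
theorem IsBoundedMorphism.mem_ext_iff {L : DL} {O : AxiomSet NC NR} {S : Set (Symbol NC NR)}
    {I J : Interpretation.{u} NC NR} {f : I.carrier → J.carrier}
    (hf : IsBoundedMorphism L O S I J f) (C : Concept NC NR) (hC : L.IsConcept O C)
    (hS : C.sig ⊆ S) (x : I.carrier) : x ∈ C.ext I ↔ f x ∈ C.ext J := by
  induction C generalizing x with
  | top => exact ⟨fun _ => trivial, fun _ => trivial⟩
  | atom A => exact hf.atom A (hS rfl) x
  | neg C ih => exact not_congr (ih hC hS x)
  | and C D ihC ihD =>
    exact and_congr (ihC hC.1 (Set.subset_union_left.trans hS) x)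
      (ihD hC.2 (Set.subset_union_right.trans hS) x)
  | or C D ihC ihD =>
    exact or_congr (ihC hC.1 (Set.subset_union_left.trans hS) x)
      (ihD hC.2 (Set.subset_union_right.trans hS) x)
  | all R C ih =>
    have hR := hS (Set.mem_union_left _ rfl)
    have ih := ih hC.2 (Set.subset_union_right.trans hS)
    constructor
    · intro h z hz
      obtain ⟨y, hy, rfl⟩ := hf.back R hC.1 hR x z hz
      exact (ih y).1 (h y hy)
    · intro h y hy
      exact (ih y).2 (h _ (hf.forth R hC.1 hR x y hy))
  | ex R C ih =>
    have hR := hS (Set.mem_union_left _ rfl)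
    have ih := ih hC.2 (Set.subset_union_right.trans hS)
    constructor
    · rintro ⟨y, hy, hyC⟩
      exact ⟨f y, hf.forth R hC.1 hR x y hy, (ih y).1 hyC⟩
    · rintro ⟨z, hz, hzC⟩
      obtain ⟨y, hy, rfl⟩ := hf.back R hC.1 hR x z hz
      exact ⟨y, hy, (ih y).2 hzC⟩
  | atMostOne R =>
    have hR := hS rfl
    constructor
    · intro h z z' hz hz'
      obtain ⟨y, hy, rfl⟩ := hf.back R hC.2.1 hR x z hz
      obtain ⟨y', hy', rfl⟩ := hf.back R hC.2.1 hR x z' hz'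
      rw [h y y' hy hy']
    · exact hf.func R hC.1 hC.2.1 hC.2.2 hR x

/-! ### Disjoint unions -/

/-- The disjoint union of a non-empty family of interpretations. -/
def Interpretation.sigma {ι : Type} [Nonempty ι] (I : ι → Interpretation.{u} NC NR) :
    Interpretation.{u} NC NR where
  carrier := Σ i, (I i).carrier
  nonempty := ⟨⟨Classical.arbitrary ι, Classical.choice (I _).nonempty⟩⟩
  conceptExt A := {x | x.2 ∈ (I x.1).conceptExt A}
  roleExt r := {p | ∃ i x y, p = (⟨i, x⟩, ⟨i, y⟩) ∧ (x, y) ∈ (I i).roleExt r}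

theorem Interpretation.mem_sigma_ext_role {ι : Type} [Nonempty ι]
    (I : ι → Interpretation.{u} NC NR) (R : Role NR) (i : ι) (x : (I i).carrier)
    (z : (sigma I).carrier) :
    ((⟨i, x⟩ : (sigma I).carrier), z) ∈ R.ext (sigma I) ↔
      ∃ y, (x, y) ∈ R.ext (I i) ∧ ⟨i, y⟩ = z := by
  cases R with
  | name r =>
    constructor
    · rintro ⟨j, x', y, h, hr⟩
      cases h
      exact ⟨y, hr, rfl⟩
    · rintro ⟨y, hr, rfl⟩
      exact ⟨i, x, y, rfl, hr⟩
  | inv r =>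
    constructor
    · rintro ⟨j, x', y, h, hr⟩
      cases h
      exact ⟨x', hr, rfl⟩
    · rintro ⟨y, hr, rfl⟩
      exact ⟨i, y, x, rfl, hr⟩

/-- Edges never leave a component, in either direction, so inverse roles cause no trouble. -/
theorem Interpretation.mem_ext_sigma {ι : Type} [Nonempty ι]
    (I : ι → Interpretation.{u} NC NR) (C : Concept NC NR) (i : ι) (x : (I i).carrier) :
    (⟨i, x⟩ : (sigma I).carrier) ∈ C.ext (sigma I) ↔ x ∈ C.ext (I i) := by
  induction C generalizing x with
  | top => exact ⟨fun _ => trivial, fun _ => trivial⟩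
  | atom A => exact Iff.rfl
  | neg C ih => exact not_congr (ih x)
  | and C D ihC ihD => exact and_congr (ihC x) (ihD x)
  | or C D ihC ihD => exact or_congr (ihC x) (ihD x)
  | all R C ih =>
    constructor
    · exact fun h y hy => (ih y).1 (h _ ((mem_sigma_ext_role I R i x _).2 ⟨y, hy, rfl⟩))
    · intro h z hz
      obtain ⟨y, hy, rfl⟩ := (mem_sigma_ext_role I R i x z).1 hz
      exact (ih y).2 (h y hy)
  | ex R C ih =>
    constructor
    · rintro ⟨z, hz, hC⟩
      obtain ⟨y, hy, rfl⟩ := (mem_sigma_ext_role I R i x z).1 hz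
      exact ⟨y, hy, (ih y).1 hC⟩
    · rintro ⟨y, hy, hC⟩
      exact ⟨_, (mem_sigma_ext_role I R i x _).2 ⟨y, hy, rfl⟩, (ih y).2 hC⟩
  | atMostOne R =>
    constructor
    · intro h y y' hy hy'
      exact eq_of_heq (Sigma.mk.inj (h _ _ ((mem_sigma_ext_role I R i x _).2 ⟨y, hy, rfl⟩)
        ((mem_sigma_ext_role I R i x _).2 ⟨y', hy', rfl⟩))).2
    · intro h z z' hz hz'
      obtain ⟨y, hy, rfl⟩ := (mem_sigma_ext_role I R i x z).1 hz
      obtain ⟨y', hy', rfl⟩ := (mem_sigma_ext_role I R i x z').1 hz'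
      rw [h y y' hy hy']

theorem Interpretation.isModel_sigma {ι : Type} [Nonempty ι]
    {I : ι → Interpretation.{u} NC NR} {O : AxiomSet NC NR} (h : ∀ i, (I i).IsModel O) :
    (sigma I).IsModel O := by
  rintro (⟨C, D⟩ | r) hα
  · rintro ⟨i, x⟩ hx
    exact (mem_ext_sigma I D i x).2 (h i _ hα ((mem_ext_sigma I C i x).1 hx))
  · rintro _ _ _ ⟨i, x, y, h₁, hr⟩ ⟨j, x', y', h₂, hr'⟩
    cases h₁
    cases h₂
    exact ⟨i, x, y', rfl, h i _ hα _ _ _ hr hr'⟩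

/-! ### Ultrapowers -/

/-- The ultrapower of an interpretation along a non-principal ultrafilter on `ℕ`. -/
noncomputable def Interpretation.ultrapower (I : Interpretation.{u} NC NR) :
    Interpretation.{u} NC NR where
  carrier := Germ (hyperfilter ℕ : Filter ℕ) I.carrier
  nonempty := I.nonempty.map fun x => ((fun _ => x : ℕ → I.carrier) : Germ _ _)
  conceptExt A := {x | x.LiftPred (· ∈ I.conceptExt A)}
  roleExt r := {p | p.1.LiftRel (fun x y => (x, y) ∈ I.roleExt r) p.2}

theorem Interpretation.mem_ultrapower_ext_role (I : Interpretation.{u} NC NR) (R : Role NR)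
    (f g : ℕ → I.carrier) :
    (((f : Germ (hyperfilter ℕ : Filter ℕ) I.carrier) : I.ultrapower.carrier),
        ((g : Germ (hyperfilter ℕ : Filter ℕ) I.carrier) : I.ultrapower.carrier)) ∈
        R.ext I.ultrapower ↔
      ∀ᶠ n in hyperfilter ℕ, (f n, g n) ∈ R.ext I := by
  cases R <;> exact Iff.rfl

/-- Łoś's theorem for concepts: witnesses are chosen index by index, with a junk value on the
negligible set of indices where none exists. -/
theorem Interpretation.mem_ext_ultrapower (I : Interpretation.{u} NC NR) (C : Concept NC NR)
    (f : ℕ → I.carrier) :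
    ((f : Germ (hyperfilter ℕ : Filter ℕ) I.carrier) : I.ultrapower.carrier) ∈
        C.ext I.ultrapower ↔
      ∀ᶠ n in hyperfilter ℕ, f n ∈ C.ext I := by
  classical
  induction C generalizing f with
  | top => exact ⟨fun _ => .of_forall fun _ => trivial, fun _ => trivial⟩
  | atom A => exact Iff.rfl
  | neg C ih => exact (not_congr (ih f)).trans Ultrafilter.eventually_not.symm
  | and C D ihC ihD => exact (and_congr (ihC f) (ihD f)).trans eventually_and.symm
  | or C D ihC ihD => exact (or_congr (ihC f) (ihD f)).trans Ultrafilter.eventually_or.symm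
  | all R C ih =>
    constructor
    · intro h
      by_contra hn
      rw [← Ultrafilter.eventually_not] at hn
      let g : ℕ → I.carrier := fun n =>
        if h : ∃ y, (f n, y) ∈ R.ext I ∧ y ∉ C.ext I then h.choose else f n
      have hg : ∀ᶠ n in hyperfilter ℕ, (f n, g n) ∈ R.ext I ∧ g n ∉ C.ext I := by
        filter_upwards [hn] with n hn
        have hn : ∃ y, (f n, y) ∈ R.ext I ∧ y ∉ C.ext I := by
          simpa [Concept.ext] using hn
        simpa only [g, dif_pos hn] using hn.choose_spec
      have h₁ := (ih g).1 (h _ ((I.mem_ultrapower_ext_role R f g).2 (hg.mono fun _ h => h.1)))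
      obtain ⟨n, h₁, h₂⟩ := (h₁.and hg).exists
      exact h₂.2 h₁
    · intro h y
      induction y using Germ.inductionOn with
      | _ g =>
        intro hg
        refine (ih g).2 ?_
        filter_upwards [h, (I.mem_ultrapower_ext_role R f g).1 hg] with n h₁ h₂
        exact h₁ _ h₂
  | ex R C ih =>
    constructor
    · rintro ⟨y, hy⟩
      induction y using Germ.inductionOn with
      | _ g =>
        filter_upwards [(I.mem_ultrapower_ext_role R f g).1 hy.1, (ih g).1 hy.2] with n h₁ h₂
        exact ⟨_, h₁, h₂⟩
    · intro h
      let g : ℕ → I.carrier := fun n =>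
        if h : ∃ y, (f n, y) ∈ R.ext I ∧ y ∈ C.ext I then h.choose else f n
      have hg : ∀ᶠ n in hyperfilter ℕ, (f n, g n) ∈ R.ext I ∧ g n ∈ C.ext I := by
        filter_upwards [h] with n hn
        have hn : ∃ y, (f n, y) ∈ R.ext I ∧ y ∈ C.ext I := hn
        simpa only [g, dif_pos hn] using hn.choose_spec
      exact ⟨_, (I.mem_ultrapower_ext_role R f g).2 (hg.mono fun _ h => h.1),
        (ih g).2 (hg.mono fun _ h => h.2)⟩
  | atMostOne R =>
    constructor
    · intro h
      by_contra hn
      rw [← Ultrafilter.eventually_not] at hn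
      let g : ℕ → I.carrier × I.carrier := fun n =>
        if h : ∃ y : I.carrier × I.carrier, (f n, y.1) ∈ R.ext I ∧ (f n, y.2) ∈ R.ext I ∧
          y.1 ≠ y.2 then h.choose else (f n, f n)
      have hg : ∀ᶠ n in hyperfilter ℕ,
          (f n, (g n).1) ∈ R.ext I ∧ (f n, (g n).2) ∈ R.ext I ∧ (g n).1 ≠ (g n).2 := by
        filter_upwards [hn] with n hn
        have hn : ∃ y : I.carrier × I.carrier, (f n, y.1) ∈ R.ext I ∧ (f n, y.2) ∈ R.ext I ∧
            y.1 ≠ y.2 := by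
          by_contra hc
          refine hn fun y y' hy hy' => ?_
          by_contra hne
          exact hc ⟨(y, y'), hy, hy', hne⟩
        simpa only [g, dif_pos hn] using hn.choose_spec
      have h₁ := h _ _
        ((I.mem_ultrapower_ext_role R f fun n => (g n).1).2 (hg.mono fun _ h => h.1))
        ((I.mem_ultrapower_ext_role R f fun n => (g n).2).2 (hg.mono fun _ h => h.2.1))
      obtain ⟨n, h₁, h₂⟩ := ((Germ.coe_eq.1 h₁).and hg).exists
      exact h₂.2.2 h₁
    · intro h y y'
      induction y using Germ.inductionOn with
      | _ g =>
      induction y' using Germ.inductionOn with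
      | _ g' =>
        intro hg hg'
        refine Germ.coe_eq.2 ?_
        filter_upwards [h, (I.mem_ultrapower_ext_role R f g).1 hg,
          (I.mem_ultrapower_ext_role R f g').1 hg'] with n h₁ h₂ h₃
        exact h₁ _ _ h₂ h₃

theorem Interpretation.isModel_ultrapower {I : Interpretation.{u} NC NR} {O : AxiomSet NC NR}
    (h : I.IsModel O) : I.ultrapower.IsModel O := by
  rintro (⟨C, D⟩ | r) hα
  · intro x
    induction x using Germ.inductionOn with
    | _ f =>
      intro hx
      exact (I.mem_ext_ultrapower D f).2
        (((I.mem_ext_ultrapower C f).1 hx).mono fun n hn => h _ hα hn)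
  · intro x y z
    induction x using Germ.inductionOn with
    | _ f₁ =>
    induction y using Germ.inductionOn with
    | _ f₂ =>
    induction z using Germ.inductionOn with
    | _ f₃ =>
      intro h₁ h₂
      refine (I.mem_ultrapower_ext_role (.name r) f₁ f₃).2 ?_
      filter_upwards [(I.mem_ultrapower_ext_role (.name r) f₁ f₂).1 h₁,
        (I.mem_ultrapower_ext_role (.name r) f₂ f₃).1 h₂] with n hn hn'
      exact h _ hα _ _ _ hn hn'

/-- Ultrapowers realise every sequence of concepts that is finitely realised among the
successors of an element. -/
theorem Interpretation.ultrapower_saturated (I : Interpretation.{u} NC NR) (R : Role NR)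
    (x : I.ultrapower.carrier) (Γ : ℕ → Concept NC NR)
    (h : ∀ n, ∃ y, (x, y) ∈ R.ext I.ultrapower ∧ ∀ j < n, y ∈ (Γ j).ext I.ultrapower) :
    ∃ y, (x, y) ∈ R.ext I.ultrapower ∧ ∀ j, y ∈ (Γ j).ext I.ultrapower := by
  classical
  induction x using Germ.inductionOn with
  | _ f =>
  have h' : ∀ n, ∃ g : ℕ → I.carrier, ∀ᶠ i in hyperfilter ℕ,
      (f i, g i) ∈ R.ext I ∧ ∀ j < n, g i ∈ (Γ j).ext I := by
    intro n
    obtain ⟨y, hy, hyΓ⟩ := h n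
    induction y using Germ.inductionOn with
    | _ g =>
      refine ⟨g, ((I.mem_ultrapower_ext_role R f g).1 hy).and ?_⟩
      have := (Filter.eventually_all_finite (Set.finite_Iio n)).2 fun j hj =>
        (I.mem_ext_ultrapower (Γ j) g).1 (hyΓ j hj)
      exact this
  choose g hg using h'
  -- Diagonalise: at index `i`, use the witness for the longest initial segment, of length at most
  -- `i`, that is realised there. Almost everywhere this length exceeds any fixed `n`.
  let P : ℕ → ℕ → Prop := fun i n => (f i, g n i) ∈ R.ext I ∧ ∀ j < n, g n i ∈ (Γ j).ext I
  let N : ℕ → ℕ := fun i => Nat.findGreatest (P i) i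
  have key : ∀ n, ∀ᶠ i in hyperfilter ℕ, n ≤ N i ∧ P i (N i) := by
    intro n
    have hn : ∀ᶠ i in hyperfilter ℕ, n ≤ i :=
      Nat.hyperfilter_le_atTop (eventually_ge_atTop n)
    filter_upwards [hn, hg n] with i hi hP
    exact ⟨Nat.le_findGreatest hi hP, Nat.findGreatest_spec (P := P i) hi hP⟩
  refine ⟨((fun i => g (N i) i : ℕ → I.carrier) : Germ _ _),
    (I.mem_ultrapower_ext_role R f _).2 ((key 0).mono fun i hi => hi.2.1), fun j =>
    (I.mem_ext_ultrapower (Γ j) _).2 ((key (j + 1)).mono fun i hi => hi.2.2 j hi.1)⟩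

/-! ### Countability of the set of concepts -/

instance [Countable NR] : Countable (Role NR) := by
  have : Function.Injective (fun R : Role NR => match R with
      | .name r => (Sum.inl r : NR ⊕ NR)
      | .inv r => Sum.inr r) := by
    rintro (r | r) (s | s) h <;> simp_all
  exact this.countable

/-- An encoding of concepts by natural numbers. -/
def Concept.code (a : NC → ℕ) (b : Role NR → ℕ) : Concept NC NR → ℕ
  | .top => Nat.pair 0 0
  | .atom A => Nat.pair 1 (a A)
  | .neg C => Nat.pair 2 (C.code a b)
  | .and C D => Nat.pair 3 (Nat.pair (C.code a b) (D.code a b))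
  | .or C D => Nat.pair 4 (Nat.pair (C.code a b) (D.code a b))
  | .all R C => Nat.pair 5 (Nat.pair (b R) (C.code a b))
  | .ex R C => Nat.pair 6 (Nat.pair (b R) (C.code a b))
  | .atMostOne R => Nat.pair 7 (b R)

theorem Concept.code_injective {a : NC → ℕ} {b : Role NR → ℕ} (ha : Function.Injective a)
    (hb : Function.Injective b) : Function.Injective (Concept.code a b) := by
  intro C D h
  induction C generalizing D with
  | top => cases D <;> simp_all [code, Nat.pair_eq_pair]
  | atom A => cases D <;> simp_all [code, Nat.pair_eq_pair, ha.eq_iff]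
  | neg C ih =>
    cases D <;> simp only [code, Nat.pair_eq_pair] at h <;> try omega
    rw [ih h.2]
  | and C D ihC ihD =>
    cases D <;> simp only [code, Nat.pair_eq_pair] at h <;> try omega
    rw [ihC h.2.1, ihD h.2.2]
  | or C D ihC ihD =>
    cases D <;> simp only [code, Nat.pair_eq_pair] at h <;> try omega
    rw [ihC h.2.1, ihD h.2.2]
  | all R C ih =>
    cases D <;> simp only [code, Nat.pair_eq_pair] at h <;> try omega
    rw [hb h.2.1, ih h.2.2]
  | ex R C ih =>
    cases D <;> simp only [code, Nat.pair_eq_pair] at h <;> try omega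
    rw [hb h.2.1, ih h.2.2]
  | atMostOne R => cases D <;> simp_all [code, Nat.pair_eq_pair, hb.eq_iff]

/-- Lets types be enumerated as sequences, which is what saturation along an ultrafilter on `ℕ` can
handle. -/
instance [Countable NC] [Countable NR] : Countable (Concept NC NR) := by
  obtain ⟨a, ha⟩ := exists_injective_nat NC
  obtain ⟨b, hb⟩ := exists_injective_nat (Role NR)
  exact (Concept.code_injective ha hb).countable

/-! ### Indistinguishability -/

/-- `C` is a concept of `L` (relative to `O`) over the signature `S`. -/
def DL.IsConceptOver (L : DL) (O : AxiomSet NC NR) (S : Set (Symbol NC NR))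
    (C : Concept NC NR) : Prop :=
  L.IsConcept O C ∧ C.sig ⊆ S

/-- Two elements belong to the same `L`-concepts over the signature `S`. -/
def DL.Indist (L : DL) (O : AxiomSet NC NR) (S : Set (Symbol NC NR))
    (I : Interpretation.{u} NC NR) (x y : I.carrier) : Prop :=
  ∀ C, L.IsConceptOver O S C → (x ∈ C.ext I ↔ y ∈ C.ext I)

theorem DL.Indist.symm {L : DL} {O : AxiomSet NC NR} {S : Set (Symbol NC NR)}
    {I : Interpretation.{u} NC NR} {x y : I.carrier} (h : L.Indist O S I x y) :
    L.Indist O S I y x :=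
  fun C hC => (h C hC).symm

/-- The conjunction of the first `n` members of a sequence of concepts. -/
def Concept.conj (Γ : ℕ → Concept NC NR) : ℕ → Concept NC NR
  | 0 => .top
  | n + 1 => .and (conj Γ n) (Γ n)

theorem Concept.mem_ext_conj (Γ : ℕ → Concept NC NR) (n : ℕ) (I : Interpretation.{u} NC NR)
    (x : I.carrier) : x ∈ (conj Γ n).ext I ↔ ∀ j < n, x ∈ (Γ j).ext I := by
  induction n with
  | zero => simp [conj, Concept.ext]
  | succ n ih =>
    rw [Nat.forall_lt_succ_right, ← ih]
    exact Iff.rfl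

theorem Concept.isConceptOver_conj {L : DL} {O : AxiomSet NC NR} {S : Set (Symbol NC NR)}
    {Γ : ℕ → Concept NC NR} (h : ∀ n, L.IsConceptOver O S (Γ n)) (n : ℕ) :
    L.IsConceptOver O S (conj Γ n) := by
  induction n with
  | zero => exact ⟨trivial, Set.empty_subset _⟩
  | succ n ih => exact ⟨⟨ih.1, (h n).1⟩, Set.union_subset ih.2 (h n).2⟩

/-- Indistinguishability is a bisimulation on ultrapowers. -/
theorem DL.Indist.exists_successor [Countable NC] [Countable NR] {L : DL} {O : AxiomSet NC NR}
    {S : Set (Symbol NC NR)} {I : Interpretation.{u} NC NR} {x y x' : I.ultrapower.carrier}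
    (h : L.Indist O S I.ultrapower x y) {R : Role NR} (hR : L.IsRole R)
    (hRS : Symbol.role R.base ∈ S) (hx : (x, x') ∈ R.ext I.ultrapower) :
    ∃ y', (y, y') ∈ R.ext I.ultrapower ∧ L.Indist O S I.ultrapower x' y' := by
  let T : Set (Concept NC NR) := {C | L.IsConceptOver O S C ∧ x' ∈ C.ext I.ultrapower}
  have hT : T.Nonempty := ⟨.top, ⟨trivial, Set.empty_subset _⟩, trivial⟩
  obtain ⟨Γ, hΓ⟩ := T.to_countable.exists_eq_range hT
  have hΓT : ∀ n, Γ n ∈ T := fun n => hΓ ▸ Set.mem_range_self n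
  obtain ⟨y', hy, hy'⟩ := I.ultrapower_saturated R y Γ fun n => by
    have hn := Concept.isConceptOver_conj (fun n => (hΓT n).1) n
    -- The existential over a finite part of the type of `x'` is itself a concept over `S`, true at
    -- `x`, hence at `y`.
    obtain ⟨y', hy, hy'⟩ := (h (.ex R (.conj Γ n))
      ⟨⟨hR, hn.1⟩, Set.union_subset (Set.singleton_subset_iff.2 hRS) hn.2⟩).1
        ⟨x', hx, (Concept.mem_ext_conj Γ n _ _).2 fun j _ => (hΓT j).2⟩
    exact ⟨y', hy, (Concept.mem_ext_conj Γ n _ _).1 hy'⟩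
  have hsub : ∀ C ∈ T, y' ∈ C.ext I.ultrapower := by
    rw [hΓ]
    rintro _ ⟨n, rfl⟩
    exact hy' n
  -- The type of `x'` contains `C` or its negation, so one inclusion of types gives equality.
  refine ⟨y', hy, fun C hC => ⟨fun hx' => hsub C ⟨hC, hx'⟩, fun hyC => ?_⟩⟩
  by_contra hx'
  exact hsub (.neg C) ⟨hC, hx'⟩ hyC

/-! ### Amalgamation -/

/-- `N`, with projections `p₁` and `p₂` to `I`, is an amalgam of two copies of `I`: symbols in `S₁`
are interpreted via `p₁`, symbols in `S₂` via `p₂`, and role edges are required to preserve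
a colour. -/
structure IsAmalgam {K : Type u} (I N : Interpretation.{u} NC NR) (S₁ S₂ : Set (Symbol NC NR))
    (p₁ p₂ : N.carrier → I.carrier) (c : NR → N.carrier → K) : Prop where
  mem_conceptExt : ∀ A w, w ∈ N.conceptExt A ↔
    (.concept A ∈ S₁ → p₁ w ∈ I.conceptExt A) ∧ (.concept A ∈ S₂ → p₂ w ∈ I.conceptExt A)
  mem_roleExt : ∀ r v w, (v, w) ∈ N.roleExt r ↔
    (.role r ∈ S₁ → (p₁ v, p₁ w) ∈ I.roleExt r) ∧
    (.role r ∈ S₂ → (p₂ v, p₂ w) ∈ I.roleExt r) ∧ c r v = c r w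

namespace IsAmalgam

variable {K : Type u} {I N : Interpretation.{u} NC NR} {S₁ S₂ : Set (Symbol NC NR)}
  {p₁ p₂ : N.carrier → I.carrier} {c : NR → N.carrier → K}

theorem swap (h : IsAmalgam I N S₁ S₂ p₁ p₂ c) : IsAmalgam I N S₂ S₁ p₂ p₁ c where
  mem_conceptExt A w := (h.mem_conceptExt A w).trans and_comm
  mem_roleExt r v w := (h.mem_roleExt r v w).trans and_left_comm

theorem mem_ext_role (h : IsAmalgam I N S₁ S₂ p₁ p₂ c) (R : Role NR) (v w : N.carrier) :
    (v, w) ∈ R.ext N ↔ (.role R.base ∈ S₁ → (p₁ v, p₁ w) ∈ R.ext I) ∧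
      (.role R.base ∈ S₂ → (p₂ v, p₂ w) ∈ R.ext I) ∧ c R.base v = c R.base w := by
  cases R with
  | name r => exact h.mem_roleExt r v w
  | inv r =>
    exact (h.mem_roleExt r w v).trans (and_congr Iff.rfl (and_congr Iff.rfl eq_comm))

theorem satisfies_trans (h : IsAmalgam I N S₁ S₂ p₁ p₂ c) {r : NR}
    (hr : I.Satisfies (.trans r)) : N.Satisfies (.trans r) := by
  intro v w z hvw hwz
  rw [h.mem_roleExt] at *
  exact ⟨fun hs => hr _ _ _ (hvw.1 hs) (hwz.1 hs), fun hs => hr _ _ _ (hvw.2.1 hs) (hwz.2.1 hs),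
    hvw.2.2.trans hwz.2.2⟩

end IsAmalgam

/-- Existence of a lift with prescribed colour gives `back`, its uniqueness gives `func`. For a
shared role the lift is fixed by both projections and the colour; for a private role by one
projection and the colour. -/
theorem IsAmalgam.isBoundedMorphism {K : Type u} [Countable NC] [Countable NR]
    {I N : Interpretation.{u} NC NR} {L : DL} {O : AxiomSet NC NR}
    {S₁ S₂ : Set (Symbol NC NR)} {p₁ p₂ : N.carrier → I.ultrapower.carrier}
    {c : NR → N.carrier → K} (hN : IsAmalgam I.ultrapower N S₁ S₂ p₁ p₂ c)
    (hp : ∀ w, L.Indist O (S₁ ∩ S₂) I.ultrapower (p₁ w) (p₂ w))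
    (hboth : ∀ r, .role r ∈ S₁ → .role r ∈ S₂ → ∀ x y k,
      L.Indist O (S₁ ∩ S₂) I.ultrapower x y → ∃! w, p₁ w = x ∧ p₂ w = y ∧ c r w = k)
    (hone : ∀ r, .role r ∈ S₁ → .role r ∉ S₂ → ∀ x k, ∃! w, p₁ w = x ∧ c r w = k) :
    IsBoundedMorphism L O S₁ N I.ultrapower p₁ where
  atom A hA w := by
    refine (hN.mem_conceptExt A w).trans ⟨fun h => h.1 hA, fun h => ⟨fun _ => h, fun hA₂ => ?_⟩⟩
    exact (hp w (.atom A) ⟨trivial, Set.singleton_subset_iff.2 ⟨hA, hA₂⟩⟩).1 h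
  forth R _ hRS v w h := ((hN.mem_ext_role R v w).1 h).1 hRS
  back R hR hRS v x h := by
    by_cases hRS₂ : .role R.base ∈ S₂
    · obtain ⟨y, hy, hxy⟩ := (hp v).exists_successor hR ⟨hRS, hRS₂⟩ h
      obtain ⟨w, ⟨rfl, rfl, hc⟩, -⟩ := hboth R.base hRS hRS₂ x y (c R.base v) hxy
      exact ⟨w, (hN.mem_ext_role R v w).2 ⟨fun _ => h, fun _ => hy, hc.symm⟩, rfl⟩
    · obtain ⟨w, ⟨rfl, hc⟩, -⟩ := hone R.base hRS hRS₂ x (c R.base v)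
      exact ⟨w, (hN.mem_ext_role R v w).2 ⟨fun _ => h, fun h₂ => absurd h₂ hRS₂, hc.symm⟩, rfl⟩
  func R hF hR hO hRS v h w w' hw hw' := by
    obtain ⟨h₁, h₂, h₃⟩ := (hN.mem_ext_role R v w).1 hw
    obtain ⟨h₁', h₂', h₃'⟩ := (hN.mem_ext_role R v w').1 hw'
    have e₁ := h _ _ (h₁ hRS) (h₁' hRS)
    by_cases hRS₂ : .role R.base ∈ S₂
    · have e₂ := (hp v (.atMostOne R)
        ⟨⟨hF, hR, hO⟩, Set.singleton_subset_iff.2 ⟨hRS, hRS₂⟩⟩).1 h _ _ (h₂ hRS₂) (h₂' hRS₂)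
      exact (hboth R.base hRS hRS₂ (p₁ w) (p₂ w) (c R.base v) (hp w)).unique
        ⟨rfl, rfl, h₃.symm⟩ ⟨e₁.symm, e₂.symm, h₃'.symm⟩
    · exact (hone R.base hRS hRS₂ (p₁ w) (c R.base v)).unique ⟨rfl, h₃.symm⟩
        ⟨e₁.symm, h₃'.symm⟩

/-- If every element of `A` is related to some element of `B`, then the fibres of the projection
from the related pairs, multiplied by a large set `K`, can be simultaneously identified
with `K`. -/
theorem exists_fibre_colouring {A B K : Type u} [Infinite K] (hK : Cardinal.mk B ≤ Cardinal.mk K)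
    (Z : A → B → Prop) (hZ : ∀ a, ∃ b, Z a b) :
    ∃ c : {p : A × B // Z p.1 p.2} × K → K, ∀ a k, ∃! w, w.1.1.1 = a ∧ c w = k := by
  -- As `K` is infinite and at least as large as `B`, every fibre has the cardinality of `K`.
  have h : ∀ a, Nonempty ({b // Z a b} × K ≃ K) := fun a => by
    obtain ⟨b, hb⟩ := hZ a
    rw [← Cardinal.eq, Cardinal.mk_prod, Cardinal.lift_id, Cardinal.lift_id]
    exact Cardinal.mul_eq_right (Cardinal.aleph0_le_mk K) ((Cardinal.mk_subtype_le _).trans hK)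
      (Cardinal.mk_ne_zero_iff.2 ⟨⟨b, hb⟩⟩)
  let e := fun a => (h a).some
  refine ⟨fun w => e w.1.1.1 (⟨w.1.1.2, w.1.2⟩, w.2), fun a k => ?_⟩
  refine ⟨(⟨(a, ((e a).symm k).1.1), ((e a).symm k).1.2⟩, ((e a).symm k).2), ⟨rfl, ?_⟩, ?_⟩
  · exact (e a).apply_symm_apply k
  · rintro ⟨⟨⟨a', b⟩, hb⟩, k'⟩ ⟨rfl, rfl⟩
    simp

/-- Indistinguishable elements of an ultrapower can be amalgamated. -/
theorem exists_amalgam [Countable NC] [Countable NR] {L : DL} {O : AxiomSet NC NR}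
    {S₁ S₂ : Set (Symbol NC NR)} {I : Interpretation.{u} NC NR} {x y : I.ultrapower.carrier}
    (hxy : L.Indist O (S₁ ∩ S₂) I.ultrapower x y) :
    ∃ (N : Interpretation.{u} NC NR) (p₁ p₂ : N.carrier → I.ultrapower.carrier) (w : N.carrier),
      (∀ r, I.ultrapower.Satisfies (.trans r) → N.Satisfies (.trans r)) ∧
      IsBoundedMorphism L O S₁ N I.ultrapower p₁ ∧ IsBoundedMorphism L O S₂ N I.ultrapower p₂ ∧
      p₁ w = x ∧ p₂ w = y := by
  classical
  let Z := L.Indist O (S₁ ∩ S₂) I.ultrapower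
  have hZ : ∀ a, ∃ b, Z a b := fun a => ⟨a, fun _ _ => Iff.rfl⟩
  have : Nonempty I.ultrapower.carrier := I.ultrapower.nonempty
  -- The factor `ℕ` makes `K` infinite even when the carrier is finite.
  let K := I.ultrapower.carrier × ℕ
  have hK : Cardinal.mk I.ultrapower.carrier ≤ Cardinal.mk K :=
    Cardinal.mk_le_of_injective (f := fun a => ((a, 0) : K)) fun a b h => congrArg Prod.fst h
  obtain ⟨c', hc'⟩ := exists_fibre_colouring hK Z hZ
  let W := {p : I.ultrapower.carrier × I.ultrapower.carrier // Z p.1 p.2} × K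
  let p₁ : W → I.ultrapower.carrier := fun w => w.1.1.1
  let p₂ : W → I.ultrapower.carrier := fun w => w.1.1.2
  let σ : W → W := fun w => (⟨(w.1.1.2, w.1.1.1), DL.Indist.symm w.1.2⟩, w.2)
  have hσ : ∀ w, σ (σ w) = w := fun _ => rfl
  -- Shared roles keep the `K`-coordinate; private roles use a colouring bijective on the fibres of
  -- their own projection, transported by `σ` for `S₂`. For roles in neither signature the choice is
  -- irrelevant.
  let c : NR → W → K := fun r w =>
    if .role r ∈ S₁ then (if .role r ∈ S₂ then w.2 else c' w) else c' (σ w)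
  let w₀ : W := (⟨(x, y), hxy⟩, (x, 0))
  have hboth : ∀ r, .role r ∈ S₁ → .role r ∈ S₂ → ∀ a b k, Z a b →
      ∃! w, p₁ w = a ∧ p₂ w = b ∧ c r w = k := by
    intro r h₁ h₂ a b k hab
    simp only [c, if_pos h₁, if_pos h₂]
    refine ⟨(⟨(a, b), hab⟩, k), ⟨rfl, rfl, rfl⟩, ?_⟩
    rintro ⟨⟨⟨a', b'⟩, h⟩, k'⟩ ⟨rfl, rfl, rfl⟩
    rfl
  have hone₁ : ∀ r, .role r ∈ S₁ → .role r ∉ S₂ → ∀ a k, ∃! w, p₁ w = a ∧ c r w = k := by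
    intro r h₁ h₂ a k
    simp only [c, if_pos h₁, if_neg h₂]
    exact hc' a k
  have hone₂ : ∀ r, .role r ∈ S₂ → .role r ∉ S₁ → ∀ a k, ∃! w, p₂ w = a ∧ c r w = k := by
    intro r h₂ h₁ a k
    simp only [c, if_neg h₁]
    obtain ⟨w, hw, hu⟩ := hc' a k
    exact ⟨σ w, hw, fun v hv => (hσ v).symm.trans (congrArg σ (hu (σ v) hv))⟩
  let N : Interpretation.{u} NC NR :=
    { carrier := W
      nonempty := ⟨w₀⟩
      conceptExt := fun A => {w | (.concept A ∈ S₁ → p₁ w ∈ I.ultrapower.conceptExt A) ∧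
        (.concept A ∈ S₂ → p₂ w ∈ I.ultrapower.conceptExt A)}
      roleExt := fun r => {w | (.role r ∈ S₁ → (p₁ w.1, p₁ w.2) ∈ I.ultrapower.roleExt r) ∧
        (.role r ∈ S₂ → (p₂ w.1, p₂ w.2) ∈ I.ultrapower.roleExt r) ∧ c r w.1 = c r w.2} }
  have hN : IsAmalgam I.ultrapower N S₁ S₂ p₁ p₂ c := ⟨fun _ _ => Iff.rfl, fun _ _ _ => Iff.rfl⟩
  refine ⟨N, p₁, p₂, w₀, fun r => hN.satisfies_trans,
    hN.isBoundedMorphism (fun w => w.1.2) hboth hone₁,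
    hN.swap.isBoundedMorphism (fun w => ?_) ?_ hone₂, rfl, rfl⟩
  · rw [Set.inter_comm]
    exact DL.Indist.symm w.1.2
  · intro r h₂ h₁ a b k hab
    rw [Set.inter_comm] at hab
    obtain ⟨w, hw, hu⟩ := hboth r h₁ h₂ b a k hab.symm
    exact ⟨w, ⟨hw.2.1, hw.1, hw.2.2⟩, fun v hv => hu v ⟨hv.2.1, hv.1, hv.2.2⟩⟩

theorem OntAxiom.sig_subset_sig {O : AxiomSet NC NR} {α : OntAxiom NC NR} (h : α ∈ O) :
    α.sig ⊆ AxiomSet.sig O :=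
  Set.subset_biUnion_of_mem (u := OntAxiom.sig) h

/-- Concept inclusions of `L` transfer along bounded morphisms. -/
theorem IsBoundedMorphism.satisfies_incl {L : DL} {O : AxiomSet NC NR} {S : Set (Symbol NC NR)}
    {I J : Interpretation.{u} NC NR} {f : I.carrier → J.carrier}
    (hf : IsBoundedMorphism L O S I J f) {C D : Concept NC NR} (hL : L.IsAxiom O (.incl C D))
    (hS : (OntAxiom.incl C D).sig ⊆ S) (h : J.Satisfies (.incl C D)) :
    I.Satisfies (.incl C D) := fun x hx =>
  (hf.mem_ext_iff D hL.2 (Set.subset_union_right.trans hS) x).2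
    (h ((hf.mem_ext_iff C hL.1 (Set.subset_union_left.trans hS) x).1 hx))

/-- If an element of `C₁` and an element outside `C₂` are indistinguishable in an ultrapower which
is a model of `O₁ ∪ O₂`, then `C₁ ⊑ C₂` is not entailed by `O₁ ∪ O₂`. -/
theorem not_entails_of_indist [Countable NC] [Countable NR] {L : DL} {O₁ O₂ : AxiomSet NC NR}
    {C₁ C₂ : Concept NC NR} (hO : L.IsOntology (O₁ ∪ O₂)) (hC₁ : L.IsConcept (O₁ ∪ O₂) C₁)
    (hC₂ : L.IsConcept (O₁ ∪ O₂) C₂) {I : Interpretation.{u} NC NR}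
    (hI : I.ultrapower.IsModel (O₁ ∪ O₂)) {x y : I.ultrapower.carrier}
    (hxy : L.Indist (O₁ ∪ O₂) ((AxiomSet.sig O₁ ∪ C₁.sig) ∩ (AxiomSet.sig O₂ ∪ C₂.sig))
      I.ultrapower x y)
    (hx : x ∈ C₁.ext I.ultrapower) (hy : y ∉ C₂.ext I.ultrapower) :
    ¬ Entails.{u} (O₁ ∪ O₂) C₁ C₂ := by
  intro hent
  obtain ⟨N, p₁, p₂, w, htrans, m₁, m₂, rfl, rfl⟩ := exists_amalgam hxy
  have hN : N.IsModel (O₁ ∪ O₂) := by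
    rintro (⟨C, D⟩ | r) hα
    -- Each inclusion is over one signature and is pulled back along that projection; `id` keeps
    -- `hα` available.
    · rcases id hα with hα' | hα'
      · exact m₁.satisfies_incl (hO.2 _ hα)
          ((OntAxiom.sig_subset_sig hα').trans Set.subset_union_left) (hI _ hα)
      · exact m₂.satisfies_incl (hO.2 _ hα)
          ((OntAxiom.sig_subset_sig hα').trans Set.subset_union_left) (hI _ hα)
    · exact htrans r (hI _ hα)
  have h₁ := (m₁.mem_ext_iff C₁ hC₁ Set.subset_union_right w).2 hx
  exact hy ((m₂.mem_ext_iff C₂ hC₂ Set.subset_union_right w).1 (hent N hN h₁))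

/-! ### Interpolation -/

/-- If membership in `C₁` and non-membership in `C₂` are always told apart by a concept from a
finite list of `L`-concepts over `S`, then `C₁` and `C₂` have an `L(S)`-interpolant. -/
theorem exists_interpolant_of_list {L : DL} {O : AxiomSet NC NR} {S : Set (Symbol NC NR)}
    (Γ : List (Concept NC NR)) (hΓ : ∀ E ∈ Γ, L.IsConceptOver O S E) (C₁ C₂ : Concept NC NR)
    (h : ∀ I J : Interpretation.{u} NC NR, I.IsModel O → J.IsModel O → ∀ x ∈ C₁.ext I,
      ∀ y ∉ C₂.ext J, ¬ ∀ E ∈ Γ, (x ∈ E.ext I ↔ y ∈ E.ext J)) :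
    ∃ J, L.IsInterpolant.{u} S O C₁ C₂ J := by
  induction Γ generalizing C₁ C₂ with
  | nil =>
    -- With no separating concepts left, either `C₁` is unsatisfiable or `C₂` holds everywhere in
    -- all models.
    by_cases h₁ : ∃ I : Interpretation.{u} NC NR, I.IsModel O ∧ ∃ x, x ∈ C₁.ext I
    · obtain ⟨I, hI, x, hx⟩ := h₁
      refine ⟨.top, trivial, Set.empty_subset _, fun J _ y _ => trivial, fun J hJ y _ => ?_⟩
      by_contra hy
      exact h I J hI hJ x hx y hy (by simp)
    · refine ⟨.neg .top, trivial, Set.empty_subset _, fun J hJ y hy => ?_,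
        fun J _ y hy => absurd trivial hy⟩
      exact absurd ⟨J, hJ, y, hy⟩ h₁
  | cons E Γ ih =>
    rw [List.forall_mem_cons] at hΓ
    -- Split on `E`: strengthening `C₁` and weakening `C₂` forces agreement on `E`, so the shorter
    -- list must separate. The two interpolants are glued by cases on `E`.
    obtain ⟨J₁, hJ₁, hs₁, h₁, h₁'⟩ := ih hΓ.2 (.and C₁ E) (.or C₂ (.neg E)) <| by
      intro I J hI hJ x hx y hy hxy
      have hyE : y ∈ E.ext J := not_not.1 fun h => hy (Or.inr h)
      exact h I J hI hJ x hx.1 y (fun h => hy (Or.inl h))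
        (List.forall_mem_cons.2 ⟨iff_of_true hx.2 hyE, hxy⟩)
    obtain ⟨J₂, hJ₂, hs₂, h₂, h₂'⟩ := ih hΓ.2 (.and C₁ (.neg E)) (.or C₂ E) <| by
      intro I J hI hJ x hx y hy hxy
      exact h I J hI hJ x hx.1 y (fun h => hy (Or.inl h))
        (List.forall_mem_cons.2 ⟨iff_of_false hx.2 fun h => hy (Or.inr h), hxy⟩)
    refine ⟨.or (.and E J₁) (.and (.neg E) J₂), ⟨⟨hΓ.1.1, hJ₁⟩, hΓ.1.1, hJ₂⟩,
      Set.union_subset (Set.union_subset hΓ.1.2 hs₁) (Set.union_subset hΓ.1.2 hs₂), ?_, ?_⟩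
    · intro I hI x hx
      by_cases hE : x ∈ E.ext I
      · exact Or.inl ⟨hE, h₁ I hI ⟨hx, hE⟩⟩
      · exact Or.inr ⟨hE, h₂ I hI ⟨hx, hE⟩⟩
    · rintro I hI x (⟨hE, hx⟩ | ⟨hE, hx⟩)
      · exact (h₁' I hI hx).resolve_right fun h => h hE
      · exact (h₂' I hI hx).resolve_right hE

/-- If there is no interpolant, then some ultrapower of a model contains indistinguishable
elements inside `C₁` and outside `C₂`, respectively. -/
theorem exists_indist_of_no_interpolant [Countable NC] [Countable NR] {L : DL}
    {O : AxiomSet NC NR} {S : Set (Symbol NC NR)} {C₁ C₂ : Concept NC NR}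
    (h : ¬ ∃ J, L.IsInterpolant.{u} S O C₁ C₂ J) :
    ∃ I : Interpretation.{u} NC NR, I.IsModel O ∧ ∃ x y : I.ultrapower.carrier,
      L.Indist O S I.ultrapower x y ∧ x ∈ C₁.ext I.ultrapower ∧ y ∉ C₂.ext I.ultrapower := by
  have hT : {C | L.IsConceptOver O S C}.Nonempty := ⟨.top, trivial, Set.empty_subset _⟩
  obtain ⟨Γ, hΓ⟩ := (Set.to_countable {C | L.IsConceptOver O S C}).exists_eq_range hT
  have hΓO : ∀ n, L.IsConceptOver O S (Γ n) := fun n => by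
    have : Γ n ∈ {C | L.IsConceptOver O S C} := hΓ ▸ Set.mem_range_self n
    exact this
  have key : ∀ n : ℕ, ∃ I : Bool → Interpretation.{u} NC NR, (∀ b, (I b).IsModel O) ∧
      ∃ x ∈ C₁.ext (I true), ∃ y ∉ C₂.ext (I false),
        ∀ j < n, (x ∈ (Γ j).ext (I true) ↔ y ∈ (Γ j).ext (I false)) := by
    intro n
    by_contra hn
    refine h (exists_interpolant_of_list ((List.range n).map Γ) ?_ C₁ C₂ ?_)
    · simp only [List.mem_map, List.mem_range]
      rintro _ ⟨j, -, rfl⟩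
      exact hΓO j
    · intro I J hI hJ x hx y hy hxy
      refine hn ⟨fun b => bif b then I else J, by rintro (_ | _) <;> assumption, x, hx, y, hy,
        fun j hj => hxy (Γ j) ?_⟩
      exact List.mem_map.2 ⟨j, List.mem_range.2 hj, rfl⟩
  choose I hI x hx y hy hxy using key
  -- One disjoint union of all the models lets both sequences of points live in the same ultrapower.
  let F : ℕ × Bool → Interpretation.{u} NC NR := fun p => I p.1 p.2
  let x' : ℕ → (Interpretation.sigma F).carrier := fun n => ⟨(n, true), x n⟩
  let y' : ℕ → (Interpretation.sigma F).carrier := fun n => ⟨(n, false), y n⟩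
  refine ⟨.sigma F, Interpretation.isModel_sigma fun p => hI p.1 p.2,
    (x' : Germ (hyperfilter ℕ : Filter ℕ) _), (y' : Germ (hyperfilter ℕ : Filter ℕ) _),
    fun C hC => ?_, ?_, fun hc => ?_⟩
  · obtain ⟨j, rfl⟩ : C ∈ Set.range Γ := hΓ ▸ hC
    refine (Interpretation.mem_ext_ultrapower _ _ _).trans
      (Iff.trans ?_ (Interpretation.mem_ext_ultrapower _ _ _).symm)
    refine eventually_congr ?_
    -- The `n`-th pair agrees on `Γ j` for `j < n`, hence from `n = j + 1` on.
    have hn : ∀ᶠ n in hyperfilter ℕ, j + 1 ≤ n :=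
      Nat.hyperfilter_le_atTop (eventually_ge_atTop (j + 1))
    filter_upwards [hn] with n hn
    exact (Interpretation.mem_ext_sigma F _ (n, true) _).trans
      ((hxy n j hn).trans (Interpretation.mem_ext_sigma F _ (n, false) _).symm)
  · exact (Interpretation.mem_ext_ultrapower _ _ _).2 (.of_forall fun n =>
      (Interpretation.mem_ext_sigma F _ (n, true) _).2 (hx n))
  · obtain ⟨n, hn⟩ := ((Interpretation.mem_ext_ultrapower _ _ _).1 hc).exists
    exact hy n ((Interpretation.mem_ext_sigma F _ (n, false) _).1 hn)

end DescriptionLogic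

/-- ALC and all its extensions by any of transitive roles, inverse roles and functionality
restrictions enjoy the Craig interpolation property. -/
theorem mainTheorem1 (NC NR : Type) [Countable NC] [Infinite NC] [Countable NR] [Infinite NR]
    (L : DescriptionLogic.DL) : DescriptionLogic.DL.HasCIP.{u} L NC NR := by
  intro O₁ O₂ C₁ C₂ hO hC₁ hC₂ hent
  by_contra h
  obtain ⟨I, hI, x, y, hxy, hx, hy⟩ := DescriptionLogic.exists_indist_of_no_interpolant h
  exact DescriptionLogic.not_entails_of_indist hO hC₁ hC₂
    (DescriptionLogic.Interpretation.isModel_ultrapower hI) hxy hx hy hent
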